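/- Let $G$ be a finite-dimensional real Lie group, let $V$ be a real vector space of finite dimension $n$ with basis $\alpha_1,\dots,\alpha_n$ and linear coordinates $x_1,\dots,x_n$, and let $\Phi:G\to \mathrm{Aut}(V)$ be a (smooth) representation with associated action $\rho:G\times V\to V$, $\rho(a,p)=\Phi(a)(p)$. The tangent bundle $TG$ is a group, whose product is the tangent map of the product of $G$ (with $TG\times TG$ identified with $T(G\times G)$). The tangent bundle $TV$ is a $2n$-dimensional real vector space with $X\oplus Y=(T\tau_y)X+(T\tau_x)Y$ for $X\in T_xV$, $Y\in T_yV$, and $\lambda\bullet X=(T\sigma_\lambda)X$, where $\tau_z$ is the translation of $V$ by $z$ and $\sigma_\lambda$ the multiplication by $\lambda$. The map $\psi:TV\to V\times\mathbb{R}^n$, $\psi(Y_p)=(p,(Y_p[x_1],\dots,Y_p[x_n]))$, is a linear isomorphism; let $\tilde\alpha_i=\psi^{-1}(\alpha_i,0)$ and $\tilde y_i=\psi^{-1}(0,e_i)$. Let $Z:\mathrm{Aut}(V)\to GL(n,\mathbb{R})$ and $\breve Z:\mathrm{Aut}(TV)\to GL(2n,\mathbb{R})$ be the isomorphisms that take an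 automorphism to its matrix with respect to $(\alpha_i)$ and to $(\tilde\alpha_1,\dots,\tilde\alpha_n,\tilde y_1,\dots,\tilde y_n)$, respectively. Let $J_n:T(GL(n,\mathbb{R}))\to GL(2n,\mathbb{R})$ be the homomorphism $$J_n(Y)=\begin{pmatrix} a&0\\ Ba&a\end{pmatrix},\qquad Y\in T_a(GL(n,\mathbb{R})),\quad B=TR_{a^{-1}}(Y),$$ where $R_{c}(y)=yc$ and $T_1(GL(n,\mathbb{R}))$ is identified with the space of $n\times n$ matrices. The prolongation of $\Phi$ is the homomorphism $$\widetilde\Phi=\breve Z^{-1}\circ J_n\circ TZ\circ T\Phi:TG\to\mathrm{Aut}(TV).$$ Then the tangent map $T\rho:TG\times TV\to TV$ (with $TG\times TV$ identified with $T(G\times V)$) is a smooth action of the group $TG$ on $TV$: $T\rho(1,Y)=Y$ and $T\rho(XX',Y)=T\rho(X,T\rho(X',Y))$ for all $X,X'\in TG$ and $Y\in TV$. It is the action that corresponds to $\widetilde\Phi$: $$T\rho(X_a,Y_p)=\widetilde\Phi(X_a)(Y_p)\qquad\text{for all } X_a\in TG,\ Y_p\in TV.$$ -/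

import Mathlib

open scoped Manifold ContDiff

noncomputable section

namespace Prolongation

section TangentFunctor

variable {E H M E₁ H₁ M₁ E₂ H₂ M₂ E₃ H₃ M₃ : Type*}
  [NormedAddCommGroup E] [NormedSpace ℝ E] [TopologicalSpace H] {I : ModelWithCorners ℝ E H}
  [TopologicalSpace M] [ChartedSpace H M]
  [NormedAddCommGroup E₁] [NormedSpace ℝ E₁] [TopologicalSpace H₁]
  {I₁ : ModelWithCorners ℝ E₁ H₁} [TopologicalSpace M₁] [ChartedSpace H₁ M₁]
  [NormedAddCommGroup E₂] [NormedSpace ℝ E₂] [TopologicalSpace H₂]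
  {I₂ : ModelWithCorners ℝ E₂ H₂} [TopologicalSpace M₂] [ChartedSpace H₂ M₂]
  [NormedAddCommGroup E₃] [NormedSpace ℝ E₃] [TopologicalSpace H₃]
  {I₃ : ModelWithCorners ℝ E₃ H₃} [TopologicalSpace M₃] [ChartedSpace H₃ M₃]

variable (I₁ I₂ I₃) in
/-- The tangent map `Tf : TM₁ × TM₂ → TM₃` of a map `f : M₁ × M₂ → M₃`, where `TM₁ × TM₂` is
identified with `T(M₁ × M₂)` in the canonical way. -/
def tangentMapProd (f : M₁ × M₂ → M₃) :
    TangentBundle I₁ M₁ × TangentBundle I₂ M₂ → TangentBundle I₃ M₃ :=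
  fun q => tangentMap (I₁.prod I₂) I₃ f ((equivTangentBundleProd I₁ M₁ I₂ M₂).symm q)

theorem tangentMapProd_tangentMap {f : M₁ × M₂ → M₃} {g₁ : M → M₁} {g₂ : M → M₂}
    (hf : MDifferentiable (I₁.prod I₂) I₃ f) (h₁ : MDifferentiable I I₁ g₁)
    (h₂ : MDifferentiable I I₂ g₂) (X : TangentBundle I M) :
    tangentMapProd I₁ I₂ I₃ f (tangentMap I I₁ g₁ X, tangentMap I I₂ g₂ X) =
      tangentMap I I₃ (fun x => f (g₁ x, g₂ x)) X := by
  have h : (equivTangentBundleProd I₁ M₁ I₂ M₂).symm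
      (tangentMap I I₁ g₁ X, tangentMap I I₂ g₂ X) =
      tangentMap I (I₁.prod I₂) (fun x => (g₁ x, g₂ x)) X := by
    simp only [tangentMap, mfderiv_prodMk (h₁ X.1) (h₂ X.1)]
    rfl
  unfold tangentMapProd
  rw [h]
  exact (congrFun (tangentMap_comp hf (h₁.prodMk h₂)) X).symm

theorem tangentMap_fst_pair (X : TangentBundle I₁ M₁) (Y : TangentBundle I₂ M₂) :
    tangentMap (I₁.prod I₂) I₁ Prod.fst ((equivTangentBundleProd I₁ M₁ I₂ M₂).symm (X, Y)) = X := by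
  rw [tangentMap_prodFst]; rfl

theorem tangentMap_snd_pair (X : TangentBundle I₁ M₁) (Y : TangentBundle I₂ M₂) :
    tangentMap (I₁.prod I₂) I₂ Prod.snd ((equivTangentBundleProd I₁ M₁ I₂ M₂).symm (X, Y)) = Y := by
  rw [tangentMap_prodSnd]; rfl

end TangentFunctor

section TangentGroup

variable {E H G E' H' G' : Type*}
  [NormedAddCommGroup E] [NormedSpace ℝ E] [TopologicalSpace H] {I : ModelWithCorners ℝ E H}
  [TopologicalSpace G] [ChartedSpace H G] [Group G]
  [NormedAddCommGroup E'] [NormedSpace ℝ E'] [TopologicalSpace H'] {I' : ModelWithCorners ℝ E' H'}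
  [TopologicalSpace G'] [ChartedSpace H' G'] [Group G']

/-- The product of `TG` is the tangent map of the product of `G`. -/
instance tangentMul : Mul (TangentBundle I G) where
  mul X Y := tangentMapProd I I I (fun q : G × G => q.1 * q.2) (X, Y)

/-- The unit element of `TG` is the zero vector at the unit element of `G`. -/
instance tangentOne : One (TangentBundle I G) where
  one := ⟨1, 0⟩

/-- The inverse of `TG` is the tangent map of the inverse of `G`. -/
instance tangentInv : Inv (TangentBundle I G) where
  inv X := tangentMap I I (fun a : G => a⁻¹) X

theorem tangent_mul_def (X Y : TangentBundle I G) :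
    X * Y = tangentMapProd I I I (fun q : G × G => q.1 * q.2) (X, Y) := rfl

theorem mdifferentiable_mul [LieGroup I ∞ G] :
    MDifferentiable (I.prod I) I (fun q : G × G => q.1 * q.2) :=
  (contMDiff_mul I ∞).mdifferentiable (by simp)

theorem mdifferentiable_inv [LieGroup I ∞ G] :
    MDifferentiable I I (fun a : G => a⁻¹) :=
  (contMDiff_inv I ∞).mdifferentiable (by simp)

theorem tangentMap_const_one (X : TangentBundle I G) :
    tangentMap I I (fun _ : G => (1 : G)) X = 1 := by
  simp only [tangentMap, mfderiv_const]
  rfl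

/-- The tangent group `TG` of a Lie group `G`. -/
instance tangentGroup [LieGroup I ∞ G] : Group (TangentBundle I G) :=
  Group.ofLeftAxioms
    (by
      intro X Y Z
      have hX := tangentMap_fst_pair X ((equivTangentBundleProd I G I G).symm (Y, Z))
      have hYZ := tangentMap_snd_pair X ((equivTangentBundleProd I G I G).symm (Y, Z))
      generalize (equivTangentBundleProd I G (I.prod I) (G × G)).symm
        (X, (equivTangentBundleProd I G I G).symm (Y, Z)) = W at hX hYZ
      have hY := tangentMap_fst_pair Y Z
      have hZ := tangentMap_snd_pair Y Z
      have d₁ : MDifferentiable (I.prod (I.prod I)) I (fun w : G × G × G => w.1) :=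
        mdifferentiable_fst
      have ds : MDifferentiable (I.prod (I.prod I)) (I.prod I) (fun w : G × G × G => w.2) :=
        mdifferentiable_snd
      have d₂ : MDifferentiable (I.prod (I.prod I)) I (fun w : G × G × G => w.2.1) :=
        mdifferentiable_fst.comp ds
      have d₃ : MDifferentiable (I.prod (I.prod I)) I (fun w : G × G × G => w.2.2) :=
        mdifferentiable_snd.comp ds
      have hX' : tangentMap (I.prod (I.prod I)) I (fun w : G × G × G => w.1) W = X := hX
      have hY' : tangentMap (I.prod (I.prod I)) I (fun w : G × G × G => w.2.1) W = Y := by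
        rw [← hYZ] at hY
        rw [← hY]
        exact congrFun (tangentMap_comp mdifferentiable_fst ds) W
      have hZ' : tangentMap (I.prod (I.prod I)) I (fun w : G × G × G => w.2.2) W = Z := by
        rw [← hYZ] at hZ
        rw [← hZ]
        exact congrFun (tangentMap_comp mdifferentiable_snd ds) W
      have dm := mdifferentiable_mul (I := I) (G := G)
      simp only [tangent_mul_def]
      have d₁₂ : MDifferentiable (I.prod (I.prod I)) I (fun w : G × G × G => w.1 * w.2.1) :=
        dm.comp (d₁.prodMk d₂)
      have d₂₃ : MDifferentiable (I.prod (I.prod I)) I (fun w : G × G × G => w.2.1 * w.2.2) :=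
        dm.comp (d₂.prodMk d₃)
      rw [← hX', ← hY', ← hZ', tangentMapProd_tangentMap dm d₁ d₂,
        tangentMapProd_tangentMap dm d₂ d₃, tangentMapProd_tangentMap dm d₁₂ d₃,
        tangentMapProd_tangentMap dm d₁ d₂₃]
      simp only [mul_assoc])
    (by
      intro X
      rw [tangent_mul_def, ← tangentMap_const_one (I := I) X]
      have := tangentMapProd_tangentMap (mdifferentiable_mul (I := I) (G := G))
        (mdifferentiable_const (I := I) (I' := I) (c := (1 : G))) mdifferentiable_id X
      simp only [id, one_mul] at this
      have hid : tangentMap I I (id : G → G) X = X := congrFun tangentMap_id X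
      rw [hid] at this
      exact this.trans hid)
    (by
      intro X
      have := tangentMapProd_tangentMap (mdifferentiable_mul (I := I) (G := G))
        (mdifferentiable_inv (I := I) (G := G)) mdifferentiable_id X
      rw [tangentMap_id] at this
      simp only [id, inv_mul_cancel] at this
      rw [tangentMap_const_one] at this
      exact this)

/-- The tangent map `Tγ : TG → TG'` of a Lie group homomorphism `γ : G → G'`, as a group
homomorphism. -/
def tangentHom [LieGroup I ∞ G] [LieGroup I' ∞ G'] (γ : ContMDiffMonoidMorphism I I' ∞ G G') :
    TangentBundle I G →* TangentBundle I' G' :=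
  MonoidHom.mk' (tangentMap I I' γ.toMonoidHom) (by
    intro X Y
    have dγ : MDifferentiable I I' γ.toMonoidHom := γ.contMDiff_toFun.mdifferentiable (by simp)
    have hX := tangentMap_fst_pair X Y
    have hY := tangentMap_snd_pair X Y
    have h : X * Y = tangentMap (I.prod I) I (fun q : G × G => q.1 * q.2)
      ((equivTangentBundleProd I G I G).symm (X, Y)) := rfl
    rw [h]
    generalize (equivTangentBundleProd I G I G).symm (X, Y) = W at hX hY
    subst hX hY
    have h₁ := congrFun (tangentMap_comp dγ (mdifferentiable_mul (I := I) (G := G))) W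
    have h₂ := congrFun (tangentMap_comp dγ
      (mdifferentiable_fst (I := I) (I' := I) (M := G) (M' := G))) W
    have h₃ := congrFun (tangentMap_comp dγ
      (mdifferentiable_snd (I := I) (I' := I) (M := G) (M' := G))) W
    simp only [Function.comp_apply] at h₁ h₂ h₃
    rw [← h₁, ← h₂, ← h₃, tangent_mul_def, tangentMapProd_tangentMap mdifferentiable_mul
      (dγ.comp mdifferentiable_fst) (dγ.comp mdifferentiable_snd)]
    simp [Function.comp_def])

end TangentGroup

section TangentVectorSpace

variable {V : Type*} [NormedAddCommGroup V] [NormedSpace ℝ V]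

/-- The sum `X ⊕ Y = (Tτ_y) X + (Tτ_x) Y` of vectors `X` at `x` and `Y` at `y`, where `τ_z` is the
translation of `V` by `z`. -/
instance tangentAdd : Add (TangentBundle 𝓘(ℝ, V) V) where
  add X Y := ⟨X.1 + Y.1,
    mfderiv 𝓘(ℝ, V) 𝓘(ℝ, V) (fun z : V => z + Y.1) X.1 X.2 +
      mfderiv 𝓘(ℝ, V) 𝓘(ℝ, V) (fun z : V => X.1 + z) Y.1 Y.2⟩

/-- The zero of the vector space `TV` is the zero vector at the origin. -/
instance tangentZero : Zero (TangentBundle 𝓘(ℝ, V) V) where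
  zero := ⟨0, 0⟩

/-- The scalar multiplication `c • X = (Tσ_c) X`, where `σ_c` is the multiplication by `c` on `V`. -/
instance tangentSMul : SMul ℝ (TangentBundle 𝓘(ℝ, V) V) where
  smul c X := tangentMap 𝓘(ℝ, V) 𝓘(ℝ, V) (fun z : V => c • z) X

instance tangentNeg : Neg (TangentBundle 𝓘(ℝ, V) V) where
  neg X := (-1 : ℝ) • X

/-- Base point and velocity of a tangent vector of `V`. -/
def velocityEquiv : TangentBundle 𝓘(ℝ, V) V ≃ V × V where
  toFun X := (X.1, X.2)
  invFun q := ⟨q.1, q.2⟩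
  left_inv _ := rfl
  right_inv _ := rfl

theorem velocityEquiv_add (X Y : TangentBundle 𝓘(ℝ, V) V) :
    velocityEquiv (X + Y) = velocityEquiv X + velocityEquiv Y := by
  refine Prod.ext rfl ?_
  change (mfderiv 𝓘(ℝ, V) 𝓘(ℝ, V) (fun z : V => z + Y.1) X.1 X.2 : V) +
      mfderiv 𝓘(ℝ, V) 𝓘(ℝ, V) (fun z : V => X.1 + z) Y.1 Y.2 = _
  rw [mfderiv_eq_fderiv, mfderiv_eq_fderiv, fderiv_add_const, fderiv_const_add]
  simp
  rfl

theorem velocityEquiv_smul (c : ℝ) (X : TangentBundle 𝓘(ℝ, V) V) :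
    velocityEquiv (c • X) = c • velocityEquiv X := by
  refine Prod.ext rfl ?_
  change (mfderiv 𝓘(ℝ, V) 𝓘(ℝ, V) (fun z : V => c • z) X.1 X.2 : V) = _
  rw [mfderiv_eq_fderiv]
  have : fderiv ℝ (fun z : V => c • z) X.1 = c • ContinuousLinearMap.id ℝ V :=
    (c • ContinuousLinearMap.id ℝ V).fderiv
  rw [this]
  rfl

theorem velocityEquiv_zero : velocityEquiv (0 : TangentBundle 𝓘(ℝ, V) V) = 0 := rfl

theorem velocityEquiv_neg (X : TangentBundle 𝓘(ℝ, V) V) :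
    velocityEquiv (-X) = -velocityEquiv X := by
  rw [← neg_one_smul ℝ (velocityEquiv X)]
  exact velocityEquiv_smul (-1) X

instance tangentAddCommGroup : AddCommGroup (TangentBundle 𝓘(ℝ, V) V) :=
  { AddGroup.ofLeftAxioms (G := TangentBundle 𝓘(ℝ, V) V)
      (fun X Y Z => velocityEquiv.injective (by simp only [velocityEquiv_add, add_assoc]))
      (fun X => velocityEquiv.injective (by
        simp only [velocityEquiv_add, velocityEquiv_zero, zero_add]))
      (fun X => velocityEquiv.injective (by
        simp only [velocityEquiv_add, velocityEquiv_neg, velocityEquiv_zero, neg_add_cancel])) with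
    add_comm := fun X Y => velocityEquiv.injective (by
      simp only [velocityEquiv_add, add_comm]) }

/-- The tangent bundle `TV` as a vector space. -/
instance tangentModule : Module ℝ (TangentBundle 𝓘(ℝ, V) V) where
  one_smul X := velocityEquiv.injective (by simp only [velocityEquiv_smul, one_smul])
  mul_smul a b X := velocityEquiv.injective (by simp only [velocityEquiv_smul, mul_smul])
  smul_zero a := velocityEquiv.injective (by
    simp only [velocityEquiv_smul, velocityEquiv_zero, smul_zero])
  smul_add a X Y := velocityEquiv.injective (by
    simp only [velocityEquiv_smul, velocityEquiv_add, smul_add])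
  add_smul a b X := velocityEquiv.injective (by
    simp only [velocityEquiv_smul, velocityEquiv_add, add_smul])
  zero_smul X := velocityEquiv.injective (by
    simp only [velocityEquiv_smul, velocityEquiv_zero, zero_smul])

variable [FiniteDimensional ℝ V] {n : ℕ}

/-- The bundle trivialization `ψ : TV → V × ℝⁿ`, `ψ(Y_p) = (p, (Y_p[x_1], …, Y_p[x_n]))`, where the
`x_i` are the linear coordinates of `V` with respect to the basis `α`. -/
def trivialization (α : Module.Basis (Fin n) ℝ V) :
    TangentBundle 𝓘(ℝ, V) V ≃ₗ[ℝ] V × (Fin n → ℝ) :=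
  have key (X : TangentBundle 𝓘(ℝ, V) V) :
      (fun i => mfderiv 𝓘(ℝ, V) 𝓘(ℝ, ℝ) (fun p : V => α.coord i p) X.1 X.2 : Fin n → ℝ) =
        α.equivFun (velocityEquiv X).2 := by
    funext i
    have : mfderiv 𝓘(ℝ, V) 𝓘(ℝ, ℝ) (fun p : V => α.coord i p) X.1 =
        LinearMap.toContinuousLinearMap (α.coord i) := by
      rw [mfderiv_eq_fderiv]
      exact (LinearMap.toContinuousLinearMap (α.coord i)).fderiv
    rw [this]
    rfl
  { toFun := fun X => (X.1, fun i => mfderiv 𝓘(ℝ, V) 𝓘(ℝ, ℝ) (fun p : V => α.coord i p) X.1 X.2)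
    invFun := fun q => ⟨q.1, α.equivFun.symm q.2⟩
    map_add' := fun X Y => Prod.ext rfl (by
      refine (key (X + Y)).trans ?_
      rw [velocityEquiv_add, Prod.snd_add, map_add, ← key, ← key]
      rfl)
    map_smul' := fun c X => Prod.ext rfl (by
      refine (key (c • X)).trans ?_
      rw [velocityEquiv_smul, Prod.smul_snd, map_smul, ← key]
      rfl)
    left_inv := fun X => velocityEquiv.injective (Prod.ext rfl (by
      refine (congrArg α.equivFun.symm (key X)).trans ?_
      exact α.equivFun.symm_apply_apply _))
    right_inv := fun q => Prod.ext rfl (by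
      refine (key _).trans ?_
      exact α.equivFun.apply_symm_apply _) }

/-- The basis `{α̃_i, ỹ_i}` of `TV`, with `ψ(α̃_i) = (α_i, 0)` and `ψ(ỹ_i) = (0, e_i)`. -/
def tangentBasis (α : Module.Basis (Fin n) ℝ V) :
    Module.Basis (Fin n ⊕ Fin n) ℝ (TangentBundle 𝓘(ℝ, V) V) :=
  (α.prod (Pi.basisFun ℝ (Fin n))).map (trivialization α).symm

end TangentVectorSpace

section Units

variable {R : Type*} [NormedRing R] [NormedAlgebra ℝ R] [CompleteSpace R]

/-- The image of a tangent vector of the open set `Rˣ` of units under the differential of the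
inclusion of `Rˣ` into `R`; for `GL(n, ℝ)` this is the matrix of entries `Y[y^i_j]`. -/
def unitsVelocity (Y : TangentBundle 𝓘(ℝ, R) Rˣ) : R :=
  mfderiv 𝓘(ℝ, R) 𝓘(ℝ, R) (fun a : Rˣ => (a : R)) Y.1 Y.2

/-- `TR_{a⁻¹}(Y)`, a tangent vector at the unit element, for a tangent vector `Y` at `a`. -/
def rightTranslate (Y : TangentBundle 𝓘(ℝ, R) Rˣ) : TangentBundle 𝓘(ℝ, R) Rˣ :=
  tangentMap 𝓘(ℝ, R) 𝓘(ℝ, R) (fun y : Rˣ => y * Y.1⁻¹) Y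

theorem mdifferentiable_unitsVal : MDifferentiable 𝓘(ℝ, R) 𝓘(ℝ, R) (fun a : Rˣ => (a : R)) :=
  (Units.contMDiff_val (n := ∞)).mdifferentiable (by simp)

theorem unitsVelocity_tangentMap {E H M : Type*} [NormedAddCommGroup E] [NormedSpace ℝ E]
    [TopologicalSpace H] {I : ModelWithCorners ℝ E H} [TopologicalSpace M] [ChartedSpace H M]
    {f : M → Rˣ} (hf : MDifferentiable I 𝓘(ℝ, R) f) (X : TangentBundle I M) :
    unitsVelocity (tangentMap I 𝓘(ℝ, R) f X) =
      mfderiv I 𝓘(ℝ, R) (fun x => (f x : R)) X.1 X.2 := by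
  have := mfderiv_comp X.1 (mdifferentiable_unitsVal (f X.1)) (hf X.1)
  exact (DFunLike.congr_fun this X.2).symm

theorem unitsVelocity_mul (X Y : TangentBundle 𝓘(ℝ, R) Rˣ) :
    unitsVelocity (X * Y) = unitsVelocity X * Y.1.val + X.1.val * unitsVelocity Y := by
  have hX := tangentMap_fst_pair X Y
  have hY := tangentMap_snd_pair X Y
  have h : X * Y = tangentMap (𝓘(ℝ, R).prod 𝓘(ℝ, R)) 𝓘(ℝ, R) (fun q : Rˣ × Rˣ => q.1 * q.2)
    ((equivTangentBundleProd 𝓘(ℝ, R) Rˣ 𝓘(ℝ, R) Rˣ).symm (X, Y)) := rfl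
  rw [h]
  generalize (equivTangentBundleProd 𝓘(ℝ, R) Rˣ 𝓘(ℝ, R) Rˣ).symm (X, Y) = W at hX hY
  subst hX hY
  rw [unitsVelocity_tangentMap mdifferentiable_mul, unitsVelocity_tangentMap mdifferentiable_fst,
    unitsVelocity_tangentMap mdifferentiable_snd]
  have d₁ : MDifferentiable (𝓘(ℝ, R).prod 𝓘(ℝ, R)) 𝓘(ℝ, R) (fun q : Rˣ × Rˣ => (q.1 : R)) :=
    mdifferentiable_unitsVal.comp mdifferentiable_fst
  have d₂ : MDifferentiable (𝓘(ℝ, R).prod 𝓘(ℝ, R)) 𝓘(ℝ, R) (fun q : Rˣ × Rˣ => (q.2 : R)) :=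
    mdifferentiable_unitsVal.comp mdifferentiable_snd
  have := ((d₁ W.1).hasMFDerivAt.mul' (d₂ W.1).hasMFDerivAt).mfderiv
  have := DFunLike.congr_fun this W.2
  refine this.trans ?_
  exact add_comm _ _

theorem unitsVelocity_rightTranslate (Y : TangentBundle 𝓘(ℝ, R) Rˣ) :
    unitsVelocity (rightTranslate Y) = unitsVelocity Y * Y.1⁻¹.val := by
  have d : MDifferentiable 𝓘(ℝ, R) 𝓘(ℝ, R) (fun y : Rˣ => y * Y.1⁻¹) :=
    mdifferentiable_mul.comp (mdifferentiable_id.prodMk mdifferentiable_const)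
  refine (unitsVelocity_tangentMap d Y).trans ?_
  have := ((mdifferentiable_unitsVal Y.1).hasMFDerivAt.mul'
    (hasMFDerivAt_const (I := 𝓘(ℝ, R)) (I' := 𝓘(ℝ, R)) (Y.1⁻¹.val : R) Y.1)).mfderiv
  have := DFunLike.congr_fun this Y.2
  refine this.trans ?_
  change (Y.1.val : R) * (0 : R) + unitsVelocity Y * Y.1⁻¹.val = _
  rw [mul_zero, zero_add]

end Units

section GeneralLinear

attribute [local instance] Matrix.linftyOpNormedRing Matrix.linftyOpNormedAlgebra
attribute [-instance] instTopologicalSpaceMatrix Matrix.instUniformSpace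

variable {n : ℕ}

/-- The homomorphism `J_n : T(GL(n, ℝ)) → GL(2n, ℝ)` that takes `[a, B]`, the tangent vector `Y` at
`a` with `B = TR_{a⁻¹}(Y)`, to the block matrix with rows `(a, 0)` and `(B a, a)`. -/
def blockHom : TangentBundle 𝓘(ℝ, Matrix (Fin n) (Fin n) ℝ) (Matrix (Fin n) (Fin n) ℝ)ˣ →*
    (Matrix (Fin n ⊕ Fin n) (Fin n ⊕ Fin n) ℝ)ˣ :=
  MonoidHom.toHomUnits
    { toFun := fun Y =>
        Matrix.fromBlocks Y.1.val 0 (unitsVelocity (rightTranslate Y) * Y.1.val) Y.1.val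
      map_one' := by
        have h : unitsVelocity
            (1 : TangentBundle 𝓘(ℝ, Matrix (Fin n) (Fin n) ℝ) (Matrix (Fin n) (Fin n) ℝ)ˣ) = 0 :=
          map_zero (mfderiv 𝓘(ℝ, Matrix (Fin n) (Fin n) ℝ) 𝓘(ℝ, Matrix (Fin n) (Fin n) ℝ)
            (fun a : (Matrix (Fin n) (Fin n) ℝ)ˣ => (a : Matrix (Fin n) (Fin n) ℝ)) 1)
        rw [unitsVelocity_rightTranslate, h, zero_mul, zero_mul]
        exact Matrix.fromBlocks_one
      map_mul' := by
        intro X Y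
        simp only [unitsVelocity_rightTranslate, Units.inv_mul_cancel_right, unitsVelocity_mul,
          Matrix.fromBlocks_multiply]
        have h : (X * Y).1 = X.1 * Y.1 := rfl
        simp [h] }

variable {V : Type*} [NormedAddCommGroup V] [NormedSpace ℝ V] [FiniteDimensional ℝ V]

/-- The isomorphism that takes an endomorphism `F` of `V` to its matrix `(F^i_j)` with respect to
the basis `α`, `F(α_j) = ∑ i, F^i_j α_i`. -/
def endToMatrix (α : Module.Basis (Fin n) ℝ V) : (V →L[ℝ] V) ≃* Matrix (Fin n) (Fin n) ℝ where
  toFun F := LinearMap.toMatrix α α (F : V →ₗ[ℝ] V)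
  invFun A := LinearMap.toContinuousLinearMap (Matrix.toLin α α A)
  left_inv F := by ext; simp
  right_inv A := by simp
  map_mul' F F' := LinearMap.toMatrix_comp α α α _ _

/-- The Lie group isomorphism `Z : Aut(V) → GL(n, ℝ)`, `Z(F) = (F^i_j)`. -/
def autToGL (α : Module.Basis (Fin n) ℝ V) :
    ContMDiffMonoidMorphism 𝓘(ℝ, V →L[ℝ] V) 𝓘(ℝ, Matrix (Fin n) (Fin n) ℝ) ∞
      (V →L[ℝ] V)ˣ (Matrix (Fin n) (Fin n) ℝ)ˣ where
  toMonoidHom := (Units.mapEquiv (endToMatrix α)).toMonoidHom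
  contMDiff_toFun := by
    apply ContMDiff.of_comp_isOpenEmbedding Units.isOpenEmbedding_val
    let L : (V →L[ℝ] V) →ₗ[ℝ] Matrix (Fin n) (Fin n) ℝ :=
      (LinearMap.toMatrix α α).toLinearMap ∘ₗ LinearMap.toContinuousLinearMap.symm.toLinearMap
    have hL : ContMDiff 𝓘(ℝ, V →L[ℝ] V) 𝓘(ℝ, Matrix (Fin n) (Fin n) ℝ) ∞ L :=
      (LinearMap.toContinuousLinearMap L).contDiff.contMDiff
    exact hL.comp Units.contMDiff_val

/-- The group isomorphism `Z̆ : Aut(TV) → GL(2n, ℝ)` that takes an automorphism of the vector space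
`TV` to its matrix with respect to the basis `{α̃_i, ỹ_i}`. -/
def autTangentToGL (α : Module.Basis (Fin n) ℝ V) :
    (TangentBundle 𝓘(ℝ, V) V ≃ₗ[ℝ] TangentBundle 𝓘(ℝ, V) V) ≃*
      (Matrix (Fin n ⊕ Fin n) (Fin n ⊕ Fin n) ℝ)ˣ :=
  (LinearMap.GeneralLinearGroup.generalLinearEquiv ℝ (TangentBundle 𝓘(ℝ, V) V)).symm.trans
    (Units.mapEquiv (LinearMap.toMatrixAlgEquiv (tangentBasis α)).toMulEquiv)

variable {E H G : Type*} [NormedAddCommGroup E] [NormedSpace ℝ E] [TopologicalSpace H]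
  {I : ModelWithCorners ℝ E H} [TopologicalSpace G] [ChartedSpace H G] [Group G] [LieGroup I ∞ G]

/-- The prolongation `Φ̃ = Z̆⁻¹ ∘ J_n ∘ TZ ∘ TΦ : TG → Aut(TV)` of a representation
`Φ : G → Aut(V)`. -/
def prolongation (α : Module.Basis (Fin n) ℝ V)
    (Φ : ContMDiffMonoidMorphism I 𝓘(ℝ, V →L[ℝ] V) ∞ G (V →L[ℝ] V)ˣ) :
    TangentBundle I G →* (TangentBundle 𝓘(ℝ, V) V ≃ₗ[ℝ] TangentBundle 𝓘(ℝ, V) V) :=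
  (autTangentToGL α).symm.toMonoidHom.comp
    (blockHom.comp ((tangentHom (autToGL α)).comp (tangentHom Φ)))

end GeneralLinear

end Prolongation

end

/-! The action laws are equalities between maps built from `ρ`, the product of `G`, projections and
constants. The tangent functor respects composition and products, so each law for `ρ` passes to `Tρ`
(`tangentMapProd_one_left`, `tangentMapProd_mul_left`); smoothness passes as well.

For the formula, describe a vector of `TV` by its base point and velocity `(p, v)`
(`velocityEquiv`). Evaluation of an endomorphism at a vector is bilinear, so the product rule gives
`Tρ(X_a, (p, v)) = (Φ(a) p, D p + Φ(a) v)`, where `D` is the derivative of `Φ` along `X_a`, taken in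
`End(V)` (`velocityEquiv_tangentMapProd_apply`). On the other side `Z` is linear, so `TZ` sends `D`
to its matrix. Since `B` is the matrix of `D Φ(a)⁻¹`, the block `B a` is the matrix of `D`, and the
block matrix acts on the coordinates of `p` and `v` by the same formula
(`velocityEquiv_prolongation`). -/

namespace Prolongation

/-! ### Coordinates on `TV` -/

section Trivialization

variable {V : Type*} [NormedAddCommGroup V] [NormedSpace ℝ V] [FiniteDimensional ℝ V] {n : ℕ}

theorem trivialization_symm_apply (α : Module.Basis (Fin n) ℝ V) (p : V) (r : Fin n → ℝ) :
    velocityEquiv ((trivialization α).symm (p, r)) = (p, α.equivFun.symm r) := rfl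

/-- The inverse of `ψ` is explicit by definition, while `ψ` itself involves the derivatives of the
coordinates; inverting avoids computing these again. -/
theorem trivialization_apply (α : Module.Basis (Fin n) ℝ V) (Y : TangentBundle 𝓘(ℝ, V) V) :
    trivialization α Y = ((velocityEquiv Y).1, α.equivFun (velocityEquiv Y).2) := by
  rw [← LinearEquiv.eq_symm_apply]
  apply velocityEquiv.injective
  rw [trivialization_symm_apply, LinearEquiv.symm_apply_apply]

/-- This splitting of the coordinates matches the two block columns of `J_n`. -/
theorem tangentBasis_repr (α : Module.Basis (Fin n) ℝ V) (Y : TangentBundle 𝓘(ℝ, V) V) :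
    ((tangentBasis α).repr Y : Fin n ⊕ Fin n → ℝ) =
      Sum.elim (α.repr (velocityEquiv Y).1) (α.repr (velocityEquiv Y).2) := by
  have h : (tangentBasis α).repr Y =
      (α.prod (Pi.basisFun ℝ (Fin n))).repr (trivialization α Y) := rfl
  rw [h, trivialization_apply]
  ext (i | i) <;> simp

end Trivialization

/-! ### The product rule for evaluation -/

section Action

variable {E H G : Type*} [NormedAddCommGroup E] [NormedSpace ℝ E] [TopologicalSpace H]
  {I : ModelWithCorners ℝ E H} [TopologicalSpace G] [ChartedSpace H G]
  {V : Type*} [NormedAddCommGroup V] [NormedSpace ℝ V]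

/-- The product rule for the evaluation `(a, p) ↦ f a p` of a family of endomorphisms. -/
theorem velocityEquiv_tangentMapProd_apply {f : G → V →L[ℝ] V}
    (hf : MDifferentiable I 𝓘(ℝ, V →L[ℝ] V) f)
    (X : TangentBundle I G) (Y : TangentBundle 𝓘(ℝ, V) V)
    {D : V →L[ℝ] V} (hD : mfderiv I 𝓘(ℝ, V →L[ℝ] V) f X.1 X.2 = D) :
    velocityEquiv (tangentMapProd I 𝓘(ℝ, V) 𝓘(ℝ, V) (fun q : G × V => f q.1 q.2) (X, Y)) =
      (f X.1 (velocityEquiv Y).1,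
        D (velocityEquiv Y).1 + f X.1 (velocityEquiv Y).2) := by
  -- `D` is a separate variable so that the derivative, a vector of a tangent space, is typed as an
  -- endomorphism and can be applied to vectors of `V`.
  subst hD
  refine Prod.ext rfl ?_
  have h₁ : HasMFDerivAt (I.prod 𝓘(ℝ, V)) 𝓘(ℝ, V →L[ℝ] V) (fun q : G × V => f q.1) (X.1, Y.1)
      ((mfderiv I 𝓘(ℝ, V →L[ℝ] V) f X.1).comp
        (ContinuousLinearMap.fst ℝ (TangentSpace I X.1) (TangentSpace 𝓘(ℝ, V) Y.1))) :=
    HasMFDerivAt.comp (X.1, Y.1) (hf X.1).hasMFDerivAt (hasMFDerivAt_fst (X.1, Y.1))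
  have h₂ : HasMFDerivAt (I.prod 𝓘(ℝ, V)) 𝓘(ℝ, V) (fun q : G × V => q.2) (X.1, Y.1)
      (ContinuousLinearMap.snd ℝ (TangentSpace I X.1) (TangentSpace 𝓘(ℝ, V) Y.1)) :=
    hasMFDerivAt_snd (X.1, Y.1)
  have he : HasMFDerivAt 𝓘(ℝ, (V →L[ℝ] V) × V) 𝓘(ℝ, V) (fun q : (V →L[ℝ] V) × V => q.1 q.2)
      (f X.1, Y.1)
      ((isBoundedBilinearMap_apply (𝕜 := ℝ) (E := V) (F := V)).deriv (f X.1, Y.1)) :=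
    (isBoundedBilinearMap_apply.hasFDerivAt (f X.1, Y.1)).hasMFDerivAt
  have h₁₂ := h₁.prodMk h₂
  -- The product manifold structure on `End(V) × V` is replaced by that of the vector space itself,
  -- the one used in `he`.
  rw [← modelWithCornersSelf_prod, chartedSpaceSelf_prod] at h₁₂
  have h := HasMFDerivAt.comp (f := fun q : G × V => (f q.1, q.2)) (X.1, Y.1) he h₁₂
  have h' := DFunLike.congr_fun h.mfderiv (X.2, Y.2)
  refine Eq.trans h' ?_
  -- The derivative of the bilinear map lists the term `f(a) v` before `D p`.
  exact add_comm _ _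

end Action

/-! ### Smoothness of the action of a representation -/

section Representation

variable {E H G : Type*} [NormedAddCommGroup E] [NormedSpace ℝ E] [TopologicalSpace H]
  {I : ModelWithCorners ℝ E H} [TopologicalSpace G] [ChartedSpace H G] [Group G]
  {V : Type*} [NormedAddCommGroup V] [NormedSpace ℝ V] [CompleteSpace V]

theorem contMDiff_representation_action
    (Φ : ContMDiffMonoidMorphism I 𝓘(ℝ, V →L[ℝ] V) ∞ G (V →L[ℝ] V)ˣ) :
    ContMDiff (I.prod 𝓘(ℝ, V)) 𝓘(ℝ, V) ∞
      (fun q : G × V => (Φ.toMonoidHom q.1 : V →L[ℝ] V) q.2) :=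
  ((Units.contMDiff_val.comp Φ.contMDiff_toFun).comp contMDiff_fst).clm_apply contMDiff_snd

end Representation

/-! ### Action laws under the tangent functor -/

section TangentAction

variable {E H G : Type*} [NormedAddCommGroup E] [NormedSpace ℝ E] [TopologicalSpace H]
  {I : ModelWithCorners ℝ E H} [TopologicalSpace G] [ChartedSpace H G] [Group G]
  {E' H' M : Type*} [NormedAddCommGroup E'] [NormedSpace ℝ E'] [TopologicalSpace H']
  {I' : ModelWithCorners ℝ E' H'} [TopologicalSpace M] [ChartedSpace H' M] {ρ : G × M → M}

/-- The pair `(1, Y)` is the image of `Y` under the tangent maps of the constant map `1` and the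
identity, so the left side is the tangent map of `p ↦ ρ (1, p) = p` at `Y`. -/
theorem tangentMapProd_one_left (hρ : MDifferentiable (I.prod I') I' ρ)
    (h : ∀ p, ρ (1, p) = p) (Y : TangentBundle I' M) :
    tangentMapProd I I' I' ρ (1, Y) = Y := by
  have h₁ : tangentMap I' I (fun _ : M => (1 : G)) Y = 1 := by
    simp only [tangentMap, mfderiv_const]
    rfl
  have hid : tangentMap I' I' (fun p : M => p) Y = Y := congrFun tangentMap_id Y
  have := tangentMapProd_tangentMap hρ (mdifferentiable_const (I := I') (c := (1 : G)))
    mdifferentiable_id Y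
  simpa only [id, h, h₁, hid, tangentMap_id] using this

/-- Both sides are values at one vector of `T(G × G × M)` of the tangent maps of `(a, b, p) ↦ ρ (a *
b, p)` and `(a, b, p) ↦ ρ (a, ρ (b, p))`, which are the same map. -/
theorem tangentMapProd_mul_left [LieGroup I ∞ G] (hρ : MDifferentiable (I.prod I') I' ρ)
    (h : ∀ a b p, ρ (a * b, p) = ρ (a, ρ (b, p)))
    (X X' : TangentBundle I G) (Y : TangentBundle I' M) :
    tangentMapProd I I' I' ρ (X * X', Y) =
      tangentMapProd I I' I' ρ (X, tangentMapProd I I' I' ρ (X', Y)) := by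
  have hX := tangentMap_fst_pair X ((equivTangentBundleProd I G I' M).symm (X', Y))
  have hs := tangentMap_snd_pair X ((equivTangentBundleProd I G I' M).symm (X', Y))
  -- Only the projections of the combined vector `W` matter: they recover `X`, `X'` and `Y` as
  -- tangent maps applied to `W`.
  generalize (equivTangentBundleProd I G (I.prod I') (G × M)).symm
    (X, (equivTangentBundleProd I G I' M).symm (X', Y)) = W at hX hs
  have hX' := tangentMap_fst_pair X' Y
  have hY := tangentMap_snd_pair X' Y
  have d₁ : MDifferentiable (I.prod (I.prod I')) I (fun w : G × G × M => w.1) :=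
    mdifferentiable_fst
  have ds : MDifferentiable (I.prod (I.prod I')) (I.prod I') (fun w : G × G × M => w.2) :=
    mdifferentiable_snd
  have d₂ : MDifferentiable (I.prod (I.prod I')) I (fun w : G × G × M => w.2.1) :=
    mdifferentiable_fst.comp ds
  have d₃ : MDifferentiable (I.prod (I.prod I')) I' (fun w : G × G × M => w.2.2) :=
    mdifferentiable_snd.comp ds
  have e₁ : tangentMap (I.prod (I.prod I')) I (fun w : G × G × M => w.1) W = X := hX
  have e₂ : tangentMap (I.prod (I.prod I')) I (fun w : G × G × M => w.2.1) W = X' := by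
    rw [← hs] at hX'
    rw [← hX']
    exact congrFun (tangentMap_comp mdifferentiable_fst ds) W
  have e₃ : tangentMap (I.prod (I.prod I')) I' (fun w : G × G × M => w.2.2) W = Y := by
    rw [← hs] at hY
    rw [← hY]
    exact congrFun (tangentMap_comp mdifferentiable_snd ds) W
  have dm := mdifferentiable_mul (I := I) (G := G)
  have d₁₂ : MDifferentiable (I.prod (I.prod I')) I (fun w : G × G × M => w.1 * w.2.1) :=
    dm.comp (d₁.prodMk d₂)
  have d₂₃ : MDifferentiable (I.prod (I.prod I')) I' (fun w : G × G × M => ρ (w.2.1, w.2.2)) :=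
    hρ.comp (d₂.prodMk d₃)
  rw [tangent_mul_def, ← e₁, ← e₂, ← e₃, tangentMapProd_tangentMap dm d₁ d₂,
    tangentMapProd_tangentMap hρ d₂ d₃, tangentMapProd_tangentMap hρ d₁₂ d₃,
    tangentMapProd_tangentMap hρ d₁ d₂₃]
  simp only [h]

end TangentAction

/-! ### Smoothness of tangent maps on products -/

section Smooth

variable {E₁ H₁ M₁ E₂ H₂ M₂ E₃ H₃ M₃ : Type*}
  [NormedAddCommGroup E₁] [NormedSpace ℝ E₁] [TopologicalSpace H₁]
  {I₁ : ModelWithCorners ℝ E₁ H₁} [TopologicalSpace M₁] [ChartedSpace H₁ M₁] [IsManifold I₁ ∞ M₁]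
  [NormedAddCommGroup E₂] [NormedSpace ℝ E₂] [TopologicalSpace H₂]
  {I₂ : ModelWithCorners ℝ E₂ H₂} [TopologicalSpace M₂] [ChartedSpace H₂ M₂] [IsManifold I₂ ∞ M₂]
  [NormedAddCommGroup E₃] [NormedSpace ℝ E₃] [TopologicalSpace H₃]
  {I₃ : ModelWithCorners ℝ E₃ H₃} [TopologicalSpace M₃] [ChartedSpace H₃ M₃] [IsManifold I₃ ∞ M₃]

theorem contMDiff_tangentMapProd {f : M₁ × M₂ → M₃} (hf : ContMDiff (I₁.prod I₂) I₃ ∞ f) :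
    ContMDiff (I₁.tangent.prod I₂.tangent) I₃.tangent ∞ (tangentMapProd I₁ I₂ I₃ f) :=
  -- Passing to the tangent map costs one derivative, which is harmless since `∞ + 1 = ∞`.
  (hf.contMDiff_tangentMap (m := ∞) (by simp)).comp contMDiff_equivTangentBundleProd_symm

end Smooth

/-! ### The prolongation in terms of base point and velocity -/

section GeneralLinear

attribute [local instance] Matrix.linftyOpNormedRing Matrix.linftyOpNormedAlgebra
attribute [-instance] instTopologicalSpaceMatrix Matrix.instUniformSpace

variable {n : ℕ} {V : Type*} [NormedAddCommGroup V] [NormedSpace ℝ V] [FiniteDimensional ℝ V]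

/-- `Z` is the restriction to the units of a linear map `L` from `End(V)` to matrices, and a linear
map is its own derivative. -/
theorem unitsVelocity_tangentHom_autToGL (α : Module.Basis (Fin n) ℝ V)
    (W : TangentBundle 𝓘(ℝ, V →L[ℝ] V) (V →L[ℝ] V)ˣ) :
    unitsVelocity (tangentHom (autToGL α) W) = endToMatrix α (unitsVelocity W) := by
  let L : (V →L[ℝ] V) →L[ℝ] Matrix (Fin n) (Fin n) ℝ := LinearMap.toContinuousLinearMap
    ((LinearMap.toMatrix α α).toLinearMap ∘ₗ LinearMap.toContinuousLinearMap.symm.toLinearMap)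
  refine (unitsVelocity_tangentMap ((autToGL α).contMDiff_toFun.mdifferentiable (by simp))
    W).trans ?_
  have h := mfderiv_comp W.1 (I := 𝓘(ℝ, V →L[ℝ] V)) (I' := 𝓘(ℝ, V →L[ℝ] V))
    (g := L) L.mdifferentiableAt (mdifferentiable_unitsVal W.1)
  rw [L.mfderiv_eq] at h
  exact DFunLike.congr_fun h W.2

theorem autTangentToGL_symm_mulVec (α : Module.Basis (Fin n) ℝ V)
    (A : (Matrix (Fin n ⊕ Fin n) (Fin n ⊕ Fin n) ℝ)ˣ) (Y : TangentBundle 𝓘(ℝ, V) V) :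
    ((tangentBasis α).repr ((autTangentToGL α).symm A Y) : Fin n ⊕ Fin n → ℝ) =
      A.val.mulVec ((tangentBasis α).repr Y) := by
  have h : (autTangentToGL α).symm A Y =
      Matrix.toLin (tangentBasis α) (tangentBasis α) A.val Y := rfl
  rw [h, Matrix.repr_toLin]

theorem endToMatrix_mulVec (α : Module.Basis (Fin n) ℝ V) (F : V →L[ℝ] V) (p : V) :
    (endToMatrix α F).mulVec (α.repr p) = α.repr (F p) :=
  LinearMap.toMatrix_mulVec_repr α α (F : V →ₗ[ℝ] V) p

variable {E H G : Type*} [NormedAddCommGroup E] [NormedSpace ℝ E] [TopologicalSpace H]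
  {I : ModelWithCorners ℝ E H} [TopologicalSpace G] [ChartedSpace H G] [Group G] [LieGroup I ∞ G]

theorem velocityEquiv_prolongation (α : Module.Basis (Fin n) ℝ V)
    (Φ : ContMDiffMonoidMorphism I 𝓘(ℝ, V →L[ℝ] V) ∞ G (V →L[ℝ] V)ˣ)
    (X : TangentBundle I G) (Y : TangentBundle 𝓘(ℝ, V) V) :
    velocityEquiv (prolongation α Φ X Y) =
      ((Φ.toMonoidHom X.1 : V →L[ℝ] V) (velocityEquiv Y).1,
        unitsVelocity (tangentHom Φ X) (velocityEquiv Y).1 +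
          (Φ.toMonoidHom X.1 : V →L[ℝ] V) (velocityEquiv Y).2) := by
  have h := autTangentToGL_symm_mulVec α (blockHom (tangentHom (autToGL α) (tangentHom Φ X))) Y
  have hb : (blockHom (tangentHom (autToGL α) (tangentHom Φ X))).val =
      Matrix.fromBlocks (endToMatrix α (Φ.toMonoidHom X.1)) 0
        (endToMatrix α (unitsVelocity (tangentHom Φ X))) (endToMatrix α (Φ.toMonoidHom X.1)) := by
    rw [← unitsVelocity_tangentHom_autToGL]
    have := unitsVelocity_rightTranslate (tangentHom (autToGL α) (tangentHom Φ X))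
    -- The right translation contributes a factor `a⁻¹`, cancelled by the factor `a` in the lower
    -- left block `B a`.
    change Matrix.fromBlocks _ _ (unitsVelocity (rightTranslate _) * _) _ = _
    rw [this, Units.inv_mul_cancel_right]
    rfl
  rw [hb, tangentBasis_repr, tangentBasis_repr, Matrix.fromBlocks_mulVec] at h
  simp only [Sum.elim_comp_inl, Sum.elim_comp_inr, endToMatrix_mulVec, Matrix.zero_mulVec,
    add_zero] at h
  have h₁ := (Sum.elim_eq_iff.mp h).1
  have h₂ := (Sum.elim_eq_iff.mp h).2
  rw [← Finsupp.coe_add, ← map_add] at h₂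
  exact Prod.ext (α.repr.injective (DFunLike.coe_injective h₁))
    (α.repr.injective (DFunLike.coe_injective h₂))

end GeneralLinear

end Prolongation

theorem proposition3p7
    {E : Type*} [NormedAddCommGroup E] [NormedSpace ℝ E] [FiniteDimensional ℝ E]
    {H : Type*} [TopologicalSpace H] {I : ModelWithCorners ℝ E H} [I.Boundaryless]
    {G : Type*} [TopologicalSpace G] [ChartedSpace H G] [Group G] [LieGroup I ∞ G]
    {V : Type*} [NormedAddCommGroup V] [NormedSpace ℝ V] [FiniteDimensional ℝ V]
    {n : ℕ} (α : Module.Basis (Fin n) ℝ V)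
    (Φ : ContMDiffMonoidMorphism I 𝓘(ℝ, V →L[ℝ] V) ∞ G (V →L[ℝ] V)ˣ)
    (ρ : G × V → V) (hρ : ∀ (a : G) (p : V), ρ (a, p) = (Φ.toMonoidHom a : V →L[ℝ] V) p)
    (Tρ : TangentBundle I G × TangentBundle 𝓘(ℝ, V) V → TangentBundle 𝓘(ℝ, V) V)
    (hTρ : Tρ = Prolongation.tangentMapProd I 𝓘(ℝ, V) 𝓘(ℝ, V) ρ) :
    (ContMDiff (I.tangent.prod 𝓘(ℝ, V).tangent) 𝓘(ℝ, V).tangent ∞ Tρ ∧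
      (∀ Y : TangentBundle 𝓘(ℝ, V) V, Tρ (1, Y) = Y) ∧
      ∀ (X X' : TangentBundle I G) (Y : TangentBundle 𝓘(ℝ, V) V),
        Tρ (X * X', Y) = Tρ (X, Tρ (X', Y))) ∧
    ∀ (X : TangentBundle I G) (Y : TangentBundle 𝓘(ℝ, V) V),
      Tρ (X, Y) = Prolongation.prolongation α Φ X Y := by
  have : CompleteSpace V := FiniteDimensional.complete ℝ V
  subst hTρ
  obtain rfl : ρ = fun q : G × V => (Φ.toMonoidHom q.1 : V →L[ℝ] V) q.2 :=
    funext fun q => hρ q.1 q.2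
  have hs := Prolongation.contMDiff_representation_action Φ
  have hd := hs.mdifferentiable (by simp)
  refine ⟨⟨Prolongation.contMDiff_tangentMapProd hs,
    Prolongation.tangentMapProd_one_left hd (fun p => by simp),
    Prolongation.tangentMapProd_mul_left hd (fun a b p => by simp)⟩, fun X Y => ?_⟩
  have hΦ : MDifferentiable I 𝓘(ℝ, V →L[ℝ] V) Φ.toMonoidHom :=
    Φ.contMDiff_toFun.mdifferentiable (by simp)
  apply Prolongation.velocityEquiv.injective
  -- The chain rule identifies the `D` of the prolongation with the derivative of `Φ` viewed as a
  -- map into `End(V)`, the `D` of the product rule.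
  have hv : Prolongation.unitsVelocity (Prolongation.tangentHom Φ X) =
      mfderiv I 𝓘(ℝ, V →L[ℝ] V) (fun a => (Φ.toMonoidHom a : V →L[ℝ] V)) X.1 X.2 :=
    Prolongation.unitsVelocity_tangentMap hΦ X
  rw [Prolongation.velocityEquiv_prolongation]
  exact Prolongation.velocityEquiv_tangentMapProd_apply
    (Prolongation.mdifferentiable_unitsVal.comp hΦ) X Y hv.symm
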